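/- Let $\omega = -\tfrac12 + \tfrac{\sqrt3}{2}i$ and $D = \mathbb{Z}[\omega] = \{a+b\omega : a,b\in\mathbb{Z}\}$, the ring of Eisenstein integers; for $m,x,y \in D$ write $x \equiv y \pmod m$ if $m \mid x-y$ in $D$. Let $\pi = a+b\omega \in D$ (with $a,b\in\mathbb{Z}$) be a prime element of $D$ that is primary, i.e. $\pi \equiv 2 \pmod 3$, and suppose $\pi \neq 2$. Then the congruence $x^{3}\equiv 2 \pmod{\pi}$ is solvable with $x\in D$ if and only if $\pi\equiv 1\pmod 2$; and $\pi \equiv 1 \pmod 2$ holds if and only if $a\equiv 1\pmod 2$ and $b\equiv 0 \pmod 2$ in $\mathbb{Z}$. -/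

import Mathlib

noncomputable section

/-- The primitive cube root of unity `ω = -1/2 + (√3/2) i` in `ℂ`. -/
def cubeRootOmega : ℂ := -1 / 2 + (Real.sqrt 3 / 2 : ℝ) * Complex.I

theorem cubeRootOmega_sq : cubeRootOmega * cubeRootOmega = -1 - cubeRootOmega := by
  have h : ((Real.sqrt 3 : ℝ) : ℂ) * ((Real.sqrt 3 : ℝ) : ℂ) = 3 := by
    rw [← Complex.ofReal_mul, Real.mul_self_sqrt (by norm_num)]
    norm_num
  have hI := Complex.I_mul_I
  unfold cubeRootOmega
  push_cast
  linear_combination (Complex.I * Complex.I / 4) * h + (3 / 4) * hI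

/-- The ring of Eisenstein integers `ℤ[ω] = {a + b ω : a, b ∈ ℤ}`, as a subring of `ℂ`. -/
def eisensteinIntegers : Subring ℂ where
  carrier := {z | ∃ a b : ℤ, z = a + b * cubeRootOmega}
  zero_mem' := ⟨0, 0, by simp⟩
  one_mem' := ⟨1, 0, by simp⟩
  add_mem' := by
    rintro _ _ ⟨a, b, rfl⟩ ⟨c, d, rfl⟩
    exact ⟨a + c, b + d, by push_cast; ring⟩
  neg_mem' := by
    rintro _ ⟨a, b, rfl⟩
    exact ⟨-a, -b, by push_cast; ring⟩
  mul_mem' := by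
    rintro _ _ ⟨a, b, rfl⟩ ⟨c, d, rfl⟩
    refine ⟨a * c - b * d, a * d + b * c - b * d, ?_⟩
    push_cast
    linear_combination ((b : ℂ) * d) * cubeRootOmega_sq

/-- The element `ω` of `ℤ[ω]`. -/
def eisensteinOmega : eisensteinIntegers := ⟨cubeRootOmega, 0, 1, by simp⟩

/-- Congruence in `ℤ[ω]`: `x ≡ y (mod m)` if `m` divides `x - y` in `ℤ[ω]`. -/
def EisensteinCongr (m x y : eisensteinIntegers) : Prop := m ∣ x - y

/-- A prime `π` of `ℤ[ω]` is primary if `π ≡ 2 (mod 3)`. -/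
def IsPrimaryPrime (π : eisensteinIntegers) : Prop :=
  Prime π ∧ EisensteinCongr 3 π 2

end

/-! Let `k = D/π`, with `3m + 1` elements, and let `χ` be the cubic residue character, `χ x ≡ x ^ m`
mod `π`. Then `J(χ, χ) = π` exactly (`jacobiSum_eq_of_primary`): `π` divides `J`, both have the same
absolute value, and both are `-1` mod `3`, which forces the unit `J/π` to be `1`. The involution `x
↦ 1 - x` pairs equal terms of `J` except at `x = 1/2`, so `π = J ≡ χ(1/2)² = χ(2)` mod `2`
(`two_dvd_jacobiSum_sub`). The cube roots of unity are distinct mod `2`, so `π ≡ 1` mod `2` iff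
`χ(2) = 1`, iff `2` is a cube in `k`. -/

/-! ### Coordinates and the norm form -/

theorem exists_eq_add_mul_eisensteinOmega (z : eisensteinIntegers) :
    ∃ a b : ℤ, z = (a : eisensteinIntegers) + (b : eisensteinIntegers) * eisensteinOmega := by
  obtain ⟨_, a, b, rfl⟩ := z
  exact ⟨a, b, Subtype.ext (by simp [eisensteinOmega])⟩

theorem coe_add_mul_eisensteinOmega (a b : ℤ) :
    (((a : eisensteinIntegers) + (b : eisensteinIntegers) * eisensteinOmega :
      eisensteinIntegers) : ℂ) = a + b * cubeRootOmega := by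
  simp [eisensteinOmega]

theorem eisensteinOmega_sq : eisensteinOmega * eisensteinOmega = -1 - eisensteinOmega :=
  Subtype.ext (by simpa [eisensteinOmega] using cubeRootOmega_sq)

theorem cubeRootOmega_re : cubeRootOmega.re = -1 / 2 := by
  have : (-1 / 2 : ℂ) = ((-1 / 2 : ℝ) : ℂ) := by push_cast; ring
  simp only [cubeRootOmega, this, Complex.add_re, Complex.ofReal_re, Complex.re_ofReal_mul,
    Complex.I_re]
  ring

theorem cubeRootOmega_im : cubeRootOmega.im = Real.sqrt 3 / 2 := by
  have : (-1 / 2 : ℂ) = ((-1 / 2 : ℝ) : ℂ) := by push_cast; ring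
  simp only [cubeRootOmega, this, Complex.add_im, Complex.ofReal_im, Complex.im_ofReal_mul,
    Complex.I_im]
  ring

theorem normSq_add_mul_eisensteinOmega (a b : ℤ) :
    Complex.normSq (((a : eisensteinIntegers) + (b : eisensteinIntegers) * eisensteinOmega :
      eisensteinIntegers) : ℂ) = ((a ^ 2 - a * b + b ^ 2 : ℤ) : ℝ) := by
  have h : Real.sqrt 3 * Real.sqrt 3 = 3 := Real.mul_self_sqrt (by norm_num)
  rw [coe_add_mul_eisensteinOmega, Complex.normSq_apply]
  simp only [Complex.add_re, Complex.add_im, Complex.mul_re, Complex.mul_im, Complex.intCast_re,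
    Complex.intCast_im, cubeRootOmega_re, cubeRootOmega_im]
  push_cast
  linear_combination (b ^ 2 / 4 : ℝ) * h

theorem add_mul_eisensteinOmega_eq_zero {a b : ℤ}
    (h : (a : eisensteinIntegers) + (b : eisensteinIntegers) * eisensteinOmega = 0) :
    a = 0 ∧ b = 0 := by
  have h1 := normSq_add_mul_eisensteinOmega a b
  rw [h, ZeroMemClass.coe_zero, map_zero] at h1
  have h2 : a ^ 2 - a * b + b ^ 2 = 0 := by exact_mod_cast h1.symm
  constructor <;> nlinarith [sq_nonneg (2 * a - b), sq_nonneg (2 * b - a), sq_nonneg a,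
    sq_nonneg b]

theorem add_mul_eisensteinOmega_inj {a b c d : ℤ}
    (h : (a : eisensteinIntegers) + (b : eisensteinIntegers) * eisensteinOmega =
      (c : eisensteinIntegers) + (d : eisensteinIntegers) * eisensteinOmega) :
    a = c ∧ b = d := by
  have h1 : ((a - c : ℤ) : eisensteinIntegers) +
      ((b - d : ℤ) : eisensteinIntegers) * eisensteinOmega = 0 := by
    push_cast
    linear_combination h
  have := add_mul_eisensteinOmega_eq_zero h1
  omega

theorem intCast_dvd_add_mul_eisensteinOmega (n a b : ℤ) :
    (n : eisensteinIntegers) ∣ (a : eisensteinIntegers) + (b : eisensteinIntegers) *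
      eisensteinOmega ↔ n ∣ a ∧ n ∣ b := by
  constructor
  · rintro ⟨z, hz⟩
    obtain ⟨c, d, rfl⟩ := exists_eq_add_mul_eisensteinOmega z
    have : a = n * c ∧ b = n * d := add_mul_eisensteinOmega_inj (by
      rw [hz]; push_cast; ring)
    exact ⟨⟨c, this.1⟩, ⟨d, this.2⟩⟩
  · rintro ⟨⟨c, rfl⟩, ⟨d, rfl⟩⟩
    exact ⟨c + d * eisensteinOmega, by push_cast; ring⟩

theorem eisensteinCongr_intCast_iff (n a b c : ℤ) :
    EisensteinCongr n ((a : eisensteinIntegers) + (b : eisensteinIntegers) * eisensteinOmega) c ↔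
      n ∣ a - c ∧ n ∣ b := by
  rw [EisensteinCongr, ← intCast_dvd_add_mul_eisensteinOmega]
  push_cast
  rw [add_sub_right_comm]

/-! ### Norm and size of residue rings -/

/-- The basis `1, ω` of the Eisenstein integers over `ℤ`. -/
noncomputable def eisensteinBasis : Module.Basis (Fin 2) ℤ eisensteinIntegers :=
  Module.Basis.ofEquivFun (LinearEquiv.symm (LinearEquiv.ofBijective
    (Fintype.linearCombination ℤ ![(1 : eisensteinIntegers), eisensteinOmega])
    ⟨by
      intro v w h
      simp only [Fintype.linearCombination_apply, Fin.sum_univ_two, Matrix.cons_val_zero,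
        Matrix.cons_val_one, zsmul_eq_mul, mul_one] at h
      have := add_mul_eisensteinOmega_inj h
      ext i
      fin_cases i
      exacts [this.1, this.2],
    by
      intro z
      obtain ⟨a, b, rfl⟩ := exists_eq_add_mul_eisensteinOmega z
      exact ⟨![a, b], by simp [Fintype.linearCombination_apply]⟩⟩))

theorem eisensteinBasis_zero : eisensteinBasis 0 = 1 := by
  simp only [eisensteinBasis, Module.Basis.coe_ofEquivFun, LinearEquiv.symm_symm]
  exact (LinearEquiv.ofBijective_apply _ _).trans (by simp [Fintype.linearCombination_apply])

theorem eisensteinBasis_one : eisensteinBasis 1 = eisensteinOmega := by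
  simp only [eisensteinBasis, Module.Basis.coe_ofEquivFun, LinearEquiv.symm_symm]
  exact (LinearEquiv.ofBijective_apply _ _).trans (by simp [Fintype.linearCombination_apply])

theorem eisensteinBasis_repr (a b : ℤ) :
    eisensteinBasis.repr ((a : eisensteinIntegers) + (b : eisensteinIntegers) * eisensteinOmega)
      = Finsupp.single 0 a + Finsupp.single 1 b := by
  have h : (a : eisensteinIntegers) + (b : eisensteinIntegers) * eisensteinOmega =
      a • eisensteinBasis 0 + b • eisensteinBasis 1 := by
    simp [eisensteinBasis_zero, eisensteinBasis_one]
  rw [h, map_add, map_zsmul, map_zsmul, Module.Basis.repr_self, Module.Basis.repr_self]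
  simp

theorem norm_add_mul_eisensteinOmega (a b : ℤ) :
    Algebra.norm ℤ ((a : eisensteinIntegers) + (b : eisensteinIntegers) * eisensteinOmega) =
      a ^ 2 - a * b + b ^ 2 := by
  have h0 : ((a : eisensteinIntegers) + (b : eisensteinIntegers) * eisensteinOmega) *
      eisensteinBasis 0 = a + b * eisensteinOmega := by rw [eisensteinBasis_zero, mul_one]
  have h1 : ((a : eisensteinIntegers) + (b : eisensteinIntegers) * eisensteinOmega) *
      eisensteinBasis 1 = ((-b : ℤ) : eisensteinIntegers) +
        ((a - b : ℤ) : eisensteinIntegers) * eisensteinOmega := by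
    rw [eisensteinBasis_one]
    push_cast
    linear_combination (b : eisensteinIntegers) * eisensteinOmega_sq
  rw [Algebra.norm_eq_matrix_det eisensteinBasis, Matrix.det_fin_two]
  simp only [Algebra.leftMulMatrix_eq_repr_mul, h0, h1, eisensteinBasis_repr]
  simp
  ring

instance : Module.Free ℤ eisensteinIntegers := Module.Free.of_basis eisensteinBasis

instance : Module.Finite ℤ eisensteinIntegers := Module.Finite.of_basis eisensteinBasis

/-- Multiplication by `r` carries a `ℤ`-basis of `R` to one of `(r)`, so the index of `(r)` is the
absolute value of its determinant. -/
theorem natCard_quotient_span_singleton {R : Type*} [CommRing R] [IsDomain R] [Module.Free ℤ R]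
    [Module.Finite ℤ R] {r : R} (hr : r ≠ 0) :
    Nat.card (R ⧸ Ideal.span {r}) = (Algebra.norm ℤ r).natAbs := by
  let b := Module.Free.chooseBasis ℤ R
  have h := Submodule.natAbs_det_equiv ((Ideal.span {r}).restrictScalars ℤ)
    (b.equiv (Ideal.basisSpanSingleton b hr) (Equiv.refl _))
  refine Eq.trans h.symm ?_
  rw [Algebra.norm_apply]
  congr 2
  refine b.ext fun i => ?_
  have hi : b.equiv (Ideal.basisSpanSingleton b hr) (Equiv.refl _) (b i) =
      Ideal.basisSpanSingleton b hr i := b.equiv_apply i _ _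
  exact (congrArg Subtype.val hi).trans (Ideal.basisSpanSingleton_apply b hr i)

theorem natCard_quotient_span_singleton_eq_normSq {π : eisensteinIntegers} (hπ : π ≠ 0) :
    (Nat.card (eisensteinIntegers ⧸ Ideal.span {π}) : ℝ) = Complex.normSq (π : ℂ) := by
  obtain ⟨a, b, rfl⟩ := exists_eq_add_mul_eisensteinOmega π
  rw [natCard_quotient_span_singleton hπ, norm_add_mul_eisensteinOmega,
    normSq_add_mul_eisensteinOmega, Nat.cast_natAbs,
    abs_of_nonneg (by nlinarith [sq_nonneg (2 * a - b), sq_nonneg b])]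

/-! ### Small elements determined modulo 3 -/

/-- An Eisenstein integer that is congruent to `1` modulo `3` and has norm at most `1` is `1`. -/
theorem eq_one_of_congr_three {u : eisensteinIntegers} (h : EisensteinCongr 3 u 1)
    (hu : Complex.normSq (u : ℂ) = 1) : u = 1 := by
  obtain ⟨a, b, rfl⟩ := exists_eq_add_mul_eisensteinOmega u
  rw [normSq_add_mul_eisensteinOmega] at hu
  have hu' : a ^ 2 - a * b + b ^ 2 = 1 := by exact_mod_cast hu
  obtain ⟨h1, h2⟩ := (eisensteinCongr_intCast_iff 3 a b 1).1 (by exact_mod_cast h)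
  have hb : b = 0 := by
    have : -2 < b := by nlinarith [sq_nonneg (2 * a - b)]
    have : b < 2 := by nlinarith [sq_nonneg (2 * a - b)]
    omega
  subst hb
  have : -2 < a := by nlinarith
  have : a < 2 := by nlinarith
  have ha : a = 1 := by omega
  simp [ha]

/-- The only prime divisor of `2` that is `2` modulo `3` is `2` itself. -/
theorem IsPrimaryPrime.eq_two_of_dvd {π : eisensteinIntegers} (hπ : IsPrimaryPrime π)
    (h : π ∣ 2) : π = 2 := by
  obtain ⟨hp, h3⟩ := hπ
  obtain ⟨z, hz⟩ := h
  obtain ⟨a, b, rfl⟩ := exists_eq_add_mul_eisensteinOmega π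
  obtain ⟨h1, h2⟩ := (eisensteinCongr_intCast_iff 3 a b 2).1 (by exact_mod_cast h3)
  have hN := congrArg (fun x : eisensteinIntegers => Complex.normSq (x : ℂ)) hz
  obtain ⟨c, d, rfl⟩ := exists_eq_add_mul_eisensteinOmega z
  have h22 : Complex.normSq ((2 : eisensteinIntegers) : ℂ) = 4 := by
    have := normSq_add_mul_eisensteinOmega 2 0
    norm_num at this
    exact_mod_cast this
  simp only [Subring.coe_mul, map_mul, normSq_add_mul_eisensteinOmega, h22] at hN
  have hN' : 4 = (a ^ 2 - a * b + b ^ 2) * (c ^ 2 - c * d + d ^ 2) := by exact_mod_cast hN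
  have hle : a ^ 2 - a * b + b ^ 2 ≤ 4 :=
    Int.le_of_dvd (by norm_num) ⟨_, hN'⟩
  -- With `N` the norm of `π`, `4N = (2a - b)² + 3b²` and `N ≤ 4` give `|b| ≤ 2`, while `3 ∣ b`.
  have hb : b = 0 := by
    have : -3 < b := by nlinarith [sq_nonneg (2 * a - b)]
    have : b < 3 := by nlinarith [sq_nonneg (2 * a - b)]
    omega
  subst hb
  have : -3 < a := by nlinarith
  have : a < 3 := by nlinarith
  have ha : a = 2 ∨ a = -1 := by omega
  rcases ha with rfl | rfl
  · simp
  · exact absurd (by simp) hp.not_isUnit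

/-! ### Cubic characters of finite fields -/

open Finset

/-- If `μ ∈ R` reduces to the `m`-th power of a generator, where `3 * m = q - 1`, there is a
multiplicative character of order `3` whose reduction is the `m`-th power map. -/
theorem exists_mulChar_map_eq_pow {k R : Type*} [Field k] [Fintype k] [CommRing R]
    (f : R →+* k) {m : ℕ} (hm : Fintype.card k = 3 * m + 1) (hm0 : m ≠ 0)
    (hf : ∀ x : k, x ^ 3 = 1 → ∃ z : R, z ^ 3 = 1 ∧ f z = x) :
    ∃ χ : MulChar k R, χ ^ 3 = 1 ∧ ∀ x, f (χ x) = x ^ m := by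
  classical
  have hcard : Fintype.card kˣ = 3 * m := by rw [Fintype.card_units, hm]; omega
  obtain ⟨g, hg⟩ := IsCyclic.exists_generator (α := kˣ)
  obtain ⟨z, hz, hzg⟩ := hf ((g : k) ^ m) (by
    rw [← pow_mul, mul_comm, ← hcard, ← Units.val_pow_eq_pow_val, pow_card_eq_one, Units.val_one])
  let μ : Rˣ := Units.ofPowEqOne z 3 hz (by norm_num)
  have hμ3 : μ ^ 3 = 1 := Units.ext (by simp [μ])
  have hμ : μ ∈ rootsOfUnity (Fintype.card kˣ) R := by
    rw [mem_rootsOfUnity, hcard, pow_mul, hμ3, one_pow]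
  have hχg : MulChar.ofRootOfUnity hμ hg g = μ := MulChar.ofRootOfUnity_spec hμ hg
  refine ⟨MulChar.ofRootOfUnity hμ hg, ?_, fun x => ?_⟩
  · rw [MulChar.eq_iff hg, MulChar.pow_apply_coe, hχg, MulChar.one_apply_coe,
      ← Units.val_pow_eq_pow_val, hμ3, Units.val_one]
  · rcases eq_or_ne x 0 with rfl | hx
    · rw [MulChar.map_zero, map_zero, zero_pow hm0]
    · obtain ⟨i, hi⟩ := (Submonoid.mem_powers_iff _ _).1
        (mem_powers_iff_mem_zpowers.2 (hg (Units.mk0 x hx)))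
      have hxi : x = (g : k) ^ i := by
        rw [← Units.val_pow_eq_pow_val, hi, Units.val_mk0]
      have hμz : (μ : R) = z := rfl
      rw [hxi, map_pow, map_pow, hχg, hμz, hzg, ← pow_mul, ← pow_mul, mul_comm]

/-- A nonzero element of a finite field with `3 * m + 1` elements is a cube if its `m`-th power
is `1`. -/
theorem exists_cube_eq_of_pow_eq_one {k : Type*} [Field k] [Fintype k] {m : ℕ}
    (hm : Fintype.card k = 3 * m + 1) (hm0 : m ≠ 0) {x : k} (hx : x ^ m = 1) :
    ∃ y, y ^ 3 = x := by
  classical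
  have hcard : Fintype.card kˣ = 3 * m := by rw [Fintype.card_units, hm]; omega
  obtain ⟨g, hg⟩ := IsCyclic.exists_generator (α := kˣ)
  have hx0 : x ≠ 0 := by rintro rfl; simp [hm0] at hx
  obtain ⟨i, hi⟩ := (Submonoid.mem_powers_iff _ _).1
    (mem_powers_iff_mem_zpowers.2 (hg (Units.mk0 x hx0)))
  have h1 : g ^ (i * m) = 1 := by
    rw [pow_mul, hi]
    exact Units.ext (by simpa using hx)
  have h2 : 3 * m ∣ i * m := by
    rw [← hcard, ← Nat.card_eq_fintype_card, ← orderOf_eq_card_of_forall_mem_zpowers hg]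
    exact orderOf_dvd_of_pow_eq_one h1
  obtain ⟨j, rfl⟩ := Nat.dvd_of_mul_dvd_mul_right (Nat.pos_of_ne_zero hm0) h2
  refine ⟨(g : k) ^ j, ?_⟩
  rw [← pow_mul, mul_comm, ← Units.val_pow_eq_pow_val, hi, Units.val_mk0]

/-- Expanding leaves only powers `x ^ i` with `i ≤ 2m < q - 1`, whose sums over `k` vanish. -/
theorem sum_pow_mul_one_sub_pow_eq_zero {k : Type*} [Field k] [Fintype k] {m : ℕ}
    (hm : 2 * m < Fintype.card k - 1) : ∑ x : k, x ^ m * (1 - x) ^ m = 0 := by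
  have h : ∀ x : k, x ^ m * (1 - x) ^ m =
      ∑ j ∈ range (m + 1), ((-1) ^ j * (m.choose j : k)) * x ^ (m + j) := fun x => by
    rw [sub_eq_neg_add, add_pow, mul_sum]
    refine sum_congr rfl fun j _ => ?_
    rw [neg_pow, one_pow, pow_add]
    ring
  simp_rw [h]
  rw [sum_comm]
  refine sum_eq_zero fun j hj => ?_
  rw [← mul_sum, FiniteField.sum_pow_lt_card_sub_one, mul_zero]
  have := mem_range.1 hj
  omega

/-! ### Jacobi sums: absolute value and congruences -/

/-- The absolute square of a Jacobi sum of a cubic character is the number of elements. -/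
theorem normSq_jacobiSum {k : Type*} [Field k] [Fintype k] {χ : MulChar k ℂ} (h1 : χ ≠ 1)
    (h2 : χ * χ ≠ 1) : Complex.normSq (jacobiSum χ χ) = Fintype.card k := by
  have hinv : jacobiSum χ⁻¹ χ⁻¹ = starRingEnd ℂ (jacobiSum χ χ) := by
    rw [← MulChar.star_eq_inv]
    exact jacobiSum_ringHomComp χ χ _
  have hchar : ringChar ℂ ≠ ringChar k := by
    rw [ringChar.eq_zero]
    exact (CharP.ringChar_ne_zero_of_finite k).symm
  have := jacobiSum_mul_jacobiSum_inv hchar h1 h1 h2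
  rw [hinv, Complex.mul_conj] at this
  exact_mod_cast this

/-- By the symmetry `x ↦ 1 - x`, a Jacobi sum `J(χ, χ)` is congruent to `χ(1/2)²` modulo `2`. -/
theorem two_dvd_jacobiSum_sub {k R : Type*} [Field k] [Fintype k] [CommRing R]
    (χ : MulChar k R) (h2 : (2 : k) ≠ 0) : (2 : R) ∣ jacobiSum χ χ - χ 2⁻¹ ^ 2 := by
  classical
  have hhalf : (1 : k) - 2⁻¹ = 2⁻¹ := by field_simp; norm_num
  rw [jacobiSum, ← add_sum_erase _ _ (mem_univ (2⁻¹ : k)), hhalf, ← sq, add_sub_cancel_left,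
    ← Ideal.mem_span_singleton, ← Ideal.Quotient.eq_zero_iff_mem, map_sum]
  refine sum_involution (fun x _ => 1 - x) (fun x _ => ?_) (fun x hx _ h => ?_) (fun x hx => ?_)
    (fun x _ => sub_sub_cancel 1 x)
  · rw [sub_sub_cancel, mul_comm (χ (1 - x)), ← map_add, Ideal.Quotient.eq_zero_iff_mem,
      Ideal.mem_span_singleton, ← two_mul]
    exact dvd_mul_right _ _
  · refine (mem_erase.1 hx).1 (eq_inv_of_mul_eq_one_left ?_)
    linear_combination -h
  · refine mem_erase.2 ⟨fun h => (mem_erase.1 hx).1 ?_, mem_univ _⟩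
    rw [← hhalf, ← h, sub_sub_cancel]

theorem eq_one_or_eq_or_eq_of_cube_eq_one {R : Type*} [CommRing R] [IsDomain R] {w x : R}
    (hw : w * w = -1 - w) (hx : x ^ 3 = 1) : x = 1 ∨ x = w ∨ x = -1 - w := by
  have h : (x - 1) * ((x - w) * (x - (-1 - w))) = 0 := by
    linear_combination hx - (x - 1) * hw
  rcases mul_eq_zero.1 h with h | h
  · exact Or.inl (sub_eq_zero.1 h)
  · exact Or.inr ((mul_eq_zero.1 h).imp sub_eq_zero.1 sub_eq_zero.1)

theorem isPrimitiveRoot_three {R : Type*} [CommRing R] {w : R} (hw : w * w = -1 - w)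
    (h1 : w ≠ 1) : IsPrimitiveRoot w 3 := by
  have : w ^ 3 = 1 := by linear_combination (w - 1) * hw
  rw [IsPrimitiveRoot.iff_orderOf]
  exact orderOf_eq_prime this h1

theorem eisensteinOmega_ne_one : eisensteinOmega ≠ 1 := fun h => by
  have := add_mul_eisensteinOmega_inj (a := 0) (b := 1) (c := 1) (d := 0) (by simpa using h)
  omega

/-- Neither `ω - 1` nor `ω² - 1` is divisible by `2`, so a congruence mod `2` can detect `χ(2) = 1`.
-/
theorem eq_one_of_cube_eq_one_of_congr_two {z : eisensteinIntegers} (hz : z ^ 3 = 1)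
    (h : EisensteinCongr 2 z 1) : z = 1 := by
  rcases eq_one_or_eq_or_eq_of_cube_eq_one eisensteinOmega_sq hz with rfl | rfl | rfl
  · rfl
  · have := (eisensteinCongr_intCast_iff 2 0 1 1).1 (by simpa using h)
    omega
  · have := (eisensteinCongr_intCast_iff 2 (-1) (-1) 1).1
      (by simpa [sub_eq_add_neg] using h)
    omega

/-- The Jacobi sum of a cubic character with values in the Eisenstein integers is `-1` modulo
`3`. -/
theorem three_dvd_jacobiSum_add_one {k : Type*} [Field k] [Fintype k] {m : ℕ}
    (hm : Fintype.card k = 3 * m + 1) {χ : MulChar k eisensteinIntegers} (hχ : χ ^ 3 = 1) :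
    3 ∣ jacobiSum χ χ + 1 := by
  classical
  obtain ⟨z, -, hz⟩ := exists_jacobiSum_eq_neg_one_add (by norm_num) hχ hχ
    ⟨m, by rw [hm, Nat.add_sub_cancel]⟩
    (isPrimitiveRoot_three eisensteinOmega_sq eisensteinOmega_ne_one)
  -- Here `J = -1 + z(ω - 1)²`, and `(ω - 1)² = -3ω`.
  refine ⟨-z * eisensteinOmega, ?_⟩
  linear_combination hz + z * eisensteinOmega_sq

/-- The Jacobi sum of the cubic residue character of a primary element `π` is `π`. -/
theorem jacobiSum_eq_of_primary {k : Type*} [Field k] [Fintype k] {m : ℕ}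
    (hm : Fintype.card k = 3 * m + 1) (hm0 : m ≠ 0) {π : eisensteinIntegers}
    (f : eisensteinIntegers →+* k) (hf : ∀ z, f z = 0 → π ∣ z)
    (hcard : (Fintype.card k : ℝ) = Complex.normSq (π : ℂ)) (h3 : EisensteinCongr 3 π 2)
    {χ : MulChar k eisensteinIntegers} (hχ3 : χ ^ 3 = 1) (hχ1 : χ ≠ 1)
    (hχ : ∀ x, f (χ x) = x ^ m) : jacobiSum χ χ = π := by
  obtain ⟨u, hu⟩ : π ∣ jacobiSum χ χ := hf _ (by
    simp only [jacobiSum, map_sum, map_mul, hχ]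
    exact sum_pow_mul_one_sub_pow_eq_zero (by omega))
  have hχ2 : χ * χ ≠ 1 := fun h => hχ1 (by rw [← hχ3, pow_succ, sq, h, one_mul])
  have hinj : Function.Injective (eisensteinIntegers.subtype) := Subtype.val_injective
  have hN := normSq_jacobiSum (χ := χ.ringHomComp eisensteinIntegers.subtype)
    ((MulChar.ringHomComp_ne_one_iff hinj).2 hχ1)
    (by rw [← MulChar.ringHomComp_mul]; exact (MulChar.ringHomComp_ne_one_iff hinj).2 hχ2)
  rw [jacobiSum_ringHomComp, hu, map_mul, Complex.normSq_mul, hcard] at hN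
  have hπ0 : Complex.normSq (π : ℂ) ≠ 0 := by
    rw [← hcard]
    exact_mod_cast Fintype.card_ne_zero
  have hu1 : Complex.normSq (u : ℂ) = 1 := mul_left_cancel₀ hπ0 (hN.trans (mul_one _).symm)
  have hu3 : EisensteinCongr 3 u 1 := by
    obtain ⟨v, hv⟩ := three_dvd_jacobiSum_add_one hm hχ3
    obtain ⟨w, hw⟩ := h3
    exact ⟨u - v + w * u, by linear_combination u * hw - hv + hu⟩
  rw [hu, eq_one_of_congr_three hu3 hu1, mul_one]

/-! ### The cubic character of 2 -/

/-- The cubic character of `2`, for a residue field `k` of a primary prime `π`. -/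
theorem exists_cube_eq_two_iff {k : Type*} [Field k] [Fintype k] {π : eisensteinIntegers}
    (f : eisensteinIntegers →+* k) (hf : ∀ z, f z = 0 ↔ π ∣ z)
    (hcard : (Fintype.card k : ℝ) = Complex.normSq (π : ℂ)) (h3 : EisensteinCongr 3 π 2)
    (h2 : (2 : k) ≠ 0) : (∃ y : k, y ^ 3 = 2) ↔ EisensteinCongr 2 π 1 := by
  classical
  have hw : f eisensteinOmega * f eisensteinOmega = -1 - f eisensteinOmega := by
    simpa using congrArg f eisensteinOmega_sq
  -- If `3 = 0` in `k`, then `π ≡ 2` mod `3` reduces to `0 = 2`.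
  have hthree : (3 : k) ≠ 0 := fun h => by
    obtain ⟨z, hz⟩ := h3
    have h0 := congrArg f hz
    rw [map_sub, (hf π).2 dvd_rfl, map_mul, map_ofNat, map_ofNat, h, zero_mul, zero_sub,
      neg_eq_zero] at h0
    exact h2 h0
  have hw1 : f eisensteinOmega ≠ 1 := fun h => hthree (by
    rw [h] at hw
    linear_combination hw)
  have hprim := isPrimitiveRoot_three hw hw1
  -- The image of `ω` has order `3` in `kˣ`.
  obtain ⟨m, hm'⟩ : 3 ∣ Fintype.card kˣ := by
    have h := (hprim.isUnit_unit (by norm_num)).eq_orderOf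
    rw [h]
    exact orderOf_dvd_card
  have hm : Fintype.card k = 3 * m + 1 := by
    rw [← hm', Fintype.card_units]
    exact (Nat.sub_add_cancel Fintype.card_pos).symm
  have hm0 : m ≠ 0 := by
    have := Fintype.one_lt_card (α := k)
    omega
  obtain ⟨χ, hχ3, hχ⟩ := exists_mulChar_map_eq_pow f hm hm0 fun x hx => by
    rcases eq_one_or_eq_or_eq_of_cube_eq_one hw hx with rfl | rfl | rfl
    · exact ⟨1, one_pow 3, map_one f⟩
    · exact ⟨eisensteinOmega,
        by linear_combination (eisensteinOmega - 1) * eisensteinOmega_sq, rfl⟩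
    · exact ⟨-1 - eisensteinOmega,
        by linear_combination (-eisensteinOmega - 2) * eisensteinOmega_sq, by simp⟩
  -- If `χ` were trivial, every element of `k` would be a cube, so cubing would be injective on the
  -- finite set `k`; but `ω` and `1` have the same cube.
  have hχ1 : χ ≠ 1 := by
    rintro rfl
    have hsurj : Function.Surjective fun y : k => y ^ 3 := fun x => by
      rcases eq_or_ne x 0 with rfl | hx
      · exact ⟨0, by simp⟩
      · refine exists_cube_eq_of_pow_eq_one hm hm0 ?_
        rw [← hχ, MulChar.one_apply hx.isUnit, map_one]
    exact hw1 (Finite.injective_iff_surjective.2 hsurj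
      (hprim.pow_eq_one.trans (one_pow 3).symm))
  have hχu : ∀ x : k, x ≠ 0 → χ x ^ 3 = 1 := fun x hx => by
    rw [← MulChar.pow_apply' χ (by norm_num), hχ3, MulChar.one_apply hx.isUnit]
  have hχ2 : χ 2⁻¹ ^ 2 = χ 2 := by
    have h : χ 2⁻¹ * χ 2 = 1 := by rw [← map_mul, inv_mul_cancel₀ h2, map_one]
    have h' := hχu 2 h2
    linear_combination (χ 2 * (χ 2⁻¹ * χ 2 + 1)) * h - χ 2⁻¹ ^ 2 * h'
  have hdvd : (2 : eisensteinIntegers) ∣ π - χ 2 := by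
    rw [← jacobiSum_eq_of_primary hm hm0 f (fun z => (hf z).1) hcard h3 hχ3 hχ1 hχ, ← hχ2]
    exact two_dvd_jacobiSum_sub χ h2
  constructor
  · rintro ⟨y, hy⟩
    have hy0 : y ≠ 0 := by
      rintro rfl
      exact h2 (by rw [← hy]; simp)
    rwa [← hy, map_pow, hχu y hy0] at hdvd
  · intro h
    have h1 : χ 2 = 1 := eq_one_of_cube_eq_one_of_congr_two (hχu 2 h2)
      (by simpa [EisensteinCongr] using dvd_sub h hdvd)
    refine exists_cube_eq_of_pow_eq_one hm hm0 ?_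
    rw [← hχ, h1, map_one]

theorem mainTheorem3 (π : eisensteinIntegers) (hπ : IsPrimaryPrime π) (hπ2 : π ≠ 2)
    (a b : ℤ) (hab : π = (a : eisensteinIntegers) + (b : eisensteinIntegers) * eisensteinOmega) :
    ((∃ x : eisensteinIntegers, EisensteinCongr π (x ^ 3) 2) ↔ EisensteinCongr 2 π 1) ∧
      (EisensteinCongr 2 π 1 ↔ a ≡ 1 [ZMOD 2] ∧ b ≡ 0 [ZMOD 2]) := by
  constructor
  · have hspan : Ideal.span {π} ≠ ⊥ := by simpa using hπ.1.ne_zero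
    have hprime : (Ideal.span {π}).IsPrime := (Ideal.span_singleton_prime hπ.1.ne_zero).2 hπ.1
    have hfin : Finite (eisensteinIntegers ⧸ Ideal.span {π}) :=
      Ideal.finiteQuotientOfFreeOfNeBot _ hspan
    have hmax : (Ideal.span {π}).IsMaximal :=
      Ideal.Quotient.maximal_of_isField _ (Finite.isField_of_domain _)
    let : Field (eisensteinIntegers ⧸ Ideal.span {π}) := Ideal.Quotient.field _
    let : Fintype (eisensteinIntegers ⧸ Ideal.span {π}) := Fintype.ofFinite _
    have hf : ∀ z, Ideal.Quotient.mk (Ideal.span {π}) z = 0 ↔ π ∣ z := fun z => by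
      rw [Ideal.Quotient.eq_zero_iff_mem, Ideal.mem_span_singleton]
    have h2 : (2 : eisensteinIntegers ⧸ Ideal.span {π}) ≠ 0 := fun h =>
      hπ2 (hπ.eq_two_of_dvd ((hf 2).1 (by rw [map_ofNat, h])))
    rw [← exists_cube_eq_two_iff (Ideal.Quotient.mk (Ideal.span {π})) hf
      (by rw [← Nat.card_eq_fintype_card, natCard_quotient_span_singleton_eq_normSq hπ.1.ne_zero])
      hπ.2 h2, Ideal.Quotient.mk_surjective.exists]
    refine exists_congr fun x => ?_
    rw [EisensteinCongr, ← hf, map_sub, map_pow, map_ofNat, sub_eq_zero]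
  · have h := eisensteinCongr_intCast_iff 2 a b 1
    rw [← hab] at h
    push_cast at h
    rw [h, Int.ModEq, Int.ModEq]
    omega
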